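/- Let $R$ be an associative ring with identity, let "module" mean left $R$-module, and let $\mathfrak X$ be a class of modules containing all projective modules. A module $G$ is called $\mathfrak X$-Gorenstein projective if there is an exact sequence $\cdots\to P_1\to P_0\to P^0\to P^1\to\cdots$ of projective modules that remains exact after applying $\operatorname{Hom}_R(-,X)$ for every $X\in\mathfrak X$ and such that $G\cong\operatorname{Ker}(P_0\to P^0)$. For a module $M$, let $\mathfrak X\text{-}\mathrm{Gpd}(M)\in\{0,1,2,\dots\}\cup\{\infty\}$ be the infimum of the integers $n\ge 0$ for which there is an exact sequence $0\to G_n\to\cdots\to G_1\to G_0\to M\to 0$ with every $G_i$ $\mathfrak X$-Gorenstein projective (and $\infty$ if there is none), and put $l.\mathfrak X\text{-}\mathrm{Ggldim}(R)=\sup\{\mathfrak X\text{-}\mathrm{Gpd}(M)\mid M\text{ a left }R\text{-module}\}$. Then for every integer $n\ge 0$ the following are equivalent: (1) $l.\mathfrak X\text{-}\mathrm{Ggldim}(R)\le n$; (2) $\mathfrak X\text{-}\mathrm{Gpd}(M)\le n$ for every finitely generated left $R$-module $M$; (3) $\mathfrak X\text{-}\mathrm{Gpd}(R/I)\le n$ for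 every left ideal $I$ of $R$. Consequently, $$l.\mathfrak X\text{-}\mathrm{Ggldim}(R)=\sup\{\mathfrak X\text{-}\mathrm{Gpd}(M)\mid M\text{ a finitely generated left }R\text{-module}\}=\sup\{\mathfrak X\text{-}\mathrm{Gpd}(R/I)\mid I\text{ a left ideal of }R\}.$$ -/

import Mathlib

open CategoryTheory

universe u

/-- The data of a doubly infinite sequence of left `R`-modules
`⋯ → P_1 → P_0 → P^0 → P^1 → ⋯`, with `left n = P_n` and `right n = P^n`. -/
structure TwoSidedSequence (R : Type u) [Ring R] where
  left : ℕ → ModuleCat.{u} R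
  right : ℕ → ModuleCat.{u} R
  dLeft : ∀ n, left (n + 1) ⟶ left n
  mid : left 0 ⟶ right 0
  dRight : ∀ n, right n ⟶ right (n + 1)

namespace TwoSidedSequence

variable {R : Type u} [Ring R]

/-- Exactness of the sequence at each of its terms. -/
structure IsExact (P : TwoSidedSequence R) : Prop where
  left_succ : ∀ n, Function.Exact (P.dLeft (n + 1)).hom (P.dLeft n).hom
  left_zero : Function.Exact (P.dLeft 0).hom P.mid.hom
  right_zero : Function.Exact P.mid.hom (P.dRight 0).hom
  right_succ : ∀ n, Function.Exact (P.dRight n).hom (P.dRight (n + 1)).hom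

/-- Exactness, at each of its terms, of the sequence of abelian groups
`⋯ → Hom(P^1, X) → Hom(P^0, X) → Hom(P_0, X) → Hom(P_1, X) → ⋯`. -/
structure IsHomExact (P : TwoSidedSequence R) (X : ModuleCat.{u} R) : Prop where
  left_succ : ∀ n, Function.Exact
    (fun f : P.left n ⟶ X => P.dLeft n ≫ f)
    (fun f : P.left (n + 1) ⟶ X => P.dLeft (n + 1) ≫ f)
  left_zero : Function.Exact
    (fun f : P.right 0 ⟶ X => P.mid ≫ f)
    (fun f : P.left 0 ⟶ X => P.dLeft 0 ≫ f)
  right_zero : Function.Exact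
    (fun f : P.right 1 ⟶ X => P.dRight 0 ≫ f)
    (fun f : P.right 0 ⟶ X => P.mid ≫ f)
  right_succ : ∀ n, Function.Exact
    (fun f : P.right (n + 2) ⟶ X => P.dRight (n + 1) ≫ f)
    (fun f : P.right (n + 1) ⟶ X => P.dRight n ≫ f)

/-- `P` is an exact sequence of projective modules that remains exact under `Hom(-, X)` for every
`X` in the class `𝔛`. -/
structure IsCompleteProjective (𝔛 : ObjectProperty (ModuleCat.{u} R))
    (P : TwoSidedSequence R) : Prop where
  projective_left : ∀ n, Module.Projective R (P.left n)
  projective_right : ∀ n, Module.Projective R (P.right n)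
  exact : P.IsExact
  hom_exact : ∀ X : ModuleCat.{u} R, 𝔛 X → P.IsHomExact X

end TwoSidedSequence

section XGorenstein

variable {R : Type u} [Ring R]

/-- `G` is `𝔛`-Gorenstein projective: `G` is (isomorphic to) the kernel of `P_0 → P^0` for some
`𝔛`-complete projective resolution `P`. -/
def IsXGorensteinProjective (𝔛 : ObjectProperty (ModuleCat.{u} R)) (G : ModuleCat.{u} R) : Prop :=
  ∃ P : TwoSidedSequence R, P.IsCompleteProjective 𝔛 ∧
    Nonempty (G ≃ₗ[R] LinearMap.ker P.mid.hom)

/-- An exact sequence `0 → G_n → ⋯ → G_1 → G_0 → M → 0` with every `G_i` `𝔛`-Gorenstein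
projective; the terms beyond degree `n` are zero modules. -/
structure XGorensteinResolution (𝔛 : ObjectProperty (ModuleCat.{u} R)) (M : ModuleCat.{u} R)
    (n : ℕ) where
  obj : ℕ → ModuleCat.{u} R
  d : ∀ i, obj (i + 1) ⟶ obj i
  augmentation : obj 0 ⟶ M
  augmentation_surjective : Function.Surjective augmentation.hom
  exact_zero : Function.Exact (d 0).hom augmentation.hom
  exact_succ : ∀ i, Function.Exact (d (i + 1)).hom (d i).hom
  gorenstein : ∀ i ≤ n, IsXGorensteinProjective 𝔛 (obj i)
  zero_of_lt : ∀ i, n < i → Subsingleton (obj i)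

/-- The `𝔛`-Gorenstein projective dimension; it is `⊤` when there is no finite resolution. -/
noncomputable def xGpd (𝔛 : ObjectProperty (ModuleCat.{u} R)) (M : ModuleCat.{u} R) : ℕ∞ :=
  sInf {k : ℕ∞ | ∃ n : ℕ, k = n ∧ Nonempty (XGorensteinResolution 𝔛 M n)}

/-- The left `𝔛`-Gorenstein global projective dimension of `R`. -/
noncomputable def leftXGgldim (𝔛 : ObjectProperty (ModuleCat.{u} R)) : ℕ∞ :=
  ⨆ M : ModuleCat.{u} R, xGpd 𝔛 M

end XGorenstein

/-! The only substantial implication is from the modules `R ⧸ I` to all modules. Well-ordering a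
module `M` filters it by submodules with cyclic successive quotients, so it suffices that the bound
"dimension at most `n`" passes from the successive quotients of a transfinite filtration to the
whole module (`HasFiltration.hasXGorensteinSyzygy`). The bound is first rewritten as: some partial
projective resolution of length `n` has an `𝔛`-Gorenstein projective `n`-th syzygy. A horseshoe
lemma for filtrations (`HasFiltration.exists_projective_cover`) then filters a syzygy of `M` by
syzygies of the quotients, which reduces everything to `n = 0`.

For `n = 0`, let `𝒮` be the class of modules filtered by `𝔛`-Gorenstein projectives. By Eklof's
lemma `Ext¹(-, X)` vanishes on `𝒮` for `X` in `𝔛`; by the horseshoe lemma members of `𝒮` have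
projective covers with kernel in `𝒮`; and by `HasFiltration.exists_projective_embedding` they embed
in projectives with cokernel in `𝒮`. The last point uses `Ext¹(C, X) = 0` for projective `X`, hence
needs projectives in `𝔛`. Splicing the resulting short exact sequences gives complete resolutions
(`IsXGorensteinProjective.of_closed`). -/

/-- `Ext¹(C, X) = 0`, stated as the extension property of maps into `X` along the kernel of every
epimorphism onto `C`. -/
def ExtOneVanishes (R : Type u) [Ring R] (C X : Type u) [AddCommGroup C] [Module R C]
    [AddCommGroup X] [Module R X] : Prop :=
  ∀ (B : Type u) [AddCommGroup B] [Module R B] (g : B →ₗ[R] C), Function.Surjective g →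
    ∀ f : LinearMap.ker g →ₗ[R] X, ∃ h : B →ₗ[R] X, ∀ x : LinearMap.ker g, h x = f x

/-! ### Transfinite extension of maps and Eklof's lemma. -/

section Extension

variable {R : Type u} [Ring R]

/-- Two maps that agree where both are defined can be glued. -/
theorem LinearPMap.exists_extension_sup_range {M Y A : Type*} [AddCommGroup M] [Module R M]
    [AddCommGroup Y] [Module R Y] [AddCommGroup A] [Module R A]
    (g : M →ₗ.[R] Y) (a : A →ₗ[R] M) (h : A →ₗ[R] Y)
    (hgh : ∀ (x : A) (hx : a x ∈ g.domain), h x = g ⟨a x, hx⟩) :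
    ∃ g' : M →ₗ.[R] Y, g ≤ g' ∧ g'.domain = g.domain ⊔ LinearMap.range a ∧
      ∀ (x : A) (hx : a x ∈ g'.domain), g' ⟨a x, hx⟩ = h x := by
  -- Since `0` lies in the domain of `g`, compatibility forces `h` to vanish on `ker a`, so `h`
  -- descends to the range of `a`.
  have hker : LinearMap.ker a ≤ LinearMap.ker h := by
    intro x hx
    rw [LinearMap.mem_ker] at hx ⊢
    have h0 : a x ∈ g.domain := by rw [hx]; exact zero_mem _
    rw [hgh x h0]
    have : (⟨a x, h0⟩ : g.domain) = 0 := Subtype.ext hx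
    rw [this, LinearPMap.map_zero]
  let k : M →ₗ.[R] Y := ⟨LinearMap.range a,
    (LinearMap.ker a).liftQ h hker ∘ₗ a.quotKerEquivRange.symm.toLinearMap⟩
  have hk : ∀ x (hx : a x ∈ k.domain), k ⟨a x, hx⟩ = h x := by
    intro x hx
    change (LinearMap.ker a).liftQ h hker (a.quotKerEquivRange.symm ⟨a x, hx⟩) = h x
    rw [LinearMap.quotKerEquivRange_symm_apply_image a x hx]
    rfl
  have compat : ∀ (x : g.domain) (y : k.domain), (x : M) = y → g x = k y := by
    rintro ⟨_, hx⟩ ⟨_, hy⟩ (rfl : _ = _)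
    obtain ⟨z, rfl⟩ := LinearMap.mem_range.1 hy
    rw [hk z hy, hgh z hx]
  refine ⟨g.sup k compat, LinearPMap.left_le_sup _ _ _, LinearPMap.domain_sup _ _ _, ?_⟩
  intro x hx
  have hx' : a x ∈ k.domain := ⟨x, rfl⟩
  rw [← hk x hx']
  exact ((LinearPMap.right_le_sup g k compat).2 rfl).symm

/-- The union of the members of a filtration that precede the index `i`. -/
def filtrationBelow {M ι : Type*} [AddCommGroup M] [Module R M] [LT ι]
    (F : ι → Submodule R M) (i : ι) : Submodule R M :=
  ⨆ j, ⨆ _ : j < i, F j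

section Filtration

variable {M ι : Type*} [AddCommGroup M] [Module R M] [LinearOrder ι]
  {F : ι → Submodule R M}

theorem le_filtrationBelow {i j : ι} (h : j < i) : F j ≤ filtrationBelow F i :=
  le_iSup₂_of_le j h le_rfl

theorem filtrationBelow_le {i : ι} {N : Submodule R M} (h : ∀ j < i, F j ≤ N) :
    filtrationBelow F i ≤ N :=
  iSup₂_le h

/-- A directed supremum of submodules is a union, unless it is empty. The alternative `x = 0` covers
the least index, below which the filtration is `⊥`. -/
theorem mem_filtrationBelow (hF : Monotone F) {i : ι} {x : M} (hx : x ∈ filtrationBelow F i) :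
    x = 0 ∨ ∃ j < i, x ∈ F j := by
  by_cases hi : ∃ j, j < i
  · right
    have : Nonempty {j // j < i} := ⟨⟨hi.choose, hi.choose_spec⟩⟩
    rw [filtrationBelow, iSup_subtype', Submodule.mem_iSup_of_directed] at hx
    · obtain ⟨j, hj⟩ := hx
      exact ⟨j, j.2, hj⟩
    · exact (hF.comp (Subtype.mono_coe _)).directed_le
  · left
    have : filtrationBelow F i ≤ ⊥ := filtrationBelow_le fun j hj => (hi ⟨j, hj⟩).elim
    exact this hx

theorem mem_of_iSup_eq_top (hF : Monotone F) (htop : ⨆ i, F i = ⊤) (x : M) :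
    x = 0 ∨ ∃ i, x ∈ F i := by
  have hx : x ∈ ⨆ i, F i := htop ▸ Submodule.mem_top
  rcases isEmpty_or_nonempty ι with h | h
  · left
    rw [iSup_of_empty] at hx
    exact hx
  · right
    exact (Submodule.mem_iSup_of_directed _ hF.directed_le).1 hx

/-- Every nonzero element has a first filtration step in which it appears. -/
theorem exists_mem_notMem_filtrationBelow [WellFoundedLT ι] (hF : Monotone F)
    (htop : ⨆ i, F i = ⊤) {x : M} (hx : x ≠ 0) :
    ∃ i, x ∈ F i ∧ x ∉ filtrationBelow F i := by
  have hne : {i | x ∈ F i}.Nonempty := (mem_of_iSup_eq_top hF htop x).resolve_left hx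
  refine ⟨wellFounded_lt.min _ hne, wellFounded_lt.min_mem _ hne, fun h => ?_⟩
  obtain ⟨j, hj, hxj⟩ := (mem_filtrationBelow hF h).resolve_left hx
  exact wellFounded_lt.not_lt_min {i | x ∈ F i} hxj hj

/-- Transfinite construction of a linear map along a well-ordered filtration, subject to a
pointwise condition on each step. -/
theorem exists_linearMap_of_filtration [WellFoundedLT ι]
    {Y : Type*} [AddCommGroup Y] [Module R Y] (f₀ : M →ₗ.[R] Y)
    (htop : f₀.domain ⊔ ⨆ i, F i = ⊤) (W : ι → M → Y → Prop)
    (step : ∀ (i : ι) (g : M →ₗ.[R] Y), g.domain = f₀.domain ⊔ filtrationBelow F i → f₀ ≤ g →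
      (∀ j < i, ∀ x : g.domain, (x : M) ∈ F j → W j x (g x)) →
      ∃ g' : M →ₗ.[R] Y, g ≤ g' ∧ g'.domain = g.domain ⊔ F i ∧
        ∀ x : g'.domain, (x : M) ∈ F i → W i x (g' x)) :
    ∃ g : M →ₗ[R] Y, (∀ x : f₀.domain, g x = f₀ x) ∧ ∀ i, ∀ x ∈ F i, W i x (g x) := by
  -- Each index is either already handled or the domain has not gone past it. This dichotomy
  -- survives unions of chains: if no member of the chain handles `i`, all their domains stay below
  -- `i`.
  let S : Set (M →ₗ.[R] Y) := {g | f₀ ≤ g ∧ ∀ i,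
    (F i ≤ g.domain ∧ ∀ x : g.domain, (x : M) ∈ F i → W i x (g x)) ∨
      g.domain ≤ f₀.domain ⊔ filtrationBelow F i}
  obtain ⟨m, -, hm⟩ := zorn_le_nonempty₀ S (by
    intro c hcS hc y hy
    have hd : DirectedOn (· ≤ ·) c := hc.directedOn
    refine ⟨LinearPMap.sSup c hd, ⟨(hcS hy).1.trans (LinearPMap.le_sSup hd hy), fun i => ?_⟩,
      fun z hz => LinearPMap.le_sSup hd hz⟩
    by_cases h : ∃ f ∈ c, F i ≤ f.domain ∧ ∀ x : f.domain, (x : M) ∈ F i → W i x (f x)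
    · obtain ⟨f, hfc, hdom, hW⟩ := h
      have hle := LinearPMap.le_sSup hd hfc
      refine Or.inl ⟨hdom.trans hle.1, fun x hx => ?_⟩
      have := hW ⟨x, hdom hx⟩ hx
      rwa [hle.2 (x := ⟨x, hdom hx⟩) (y := x) rfl] at this
    · right
      rw [LinearPMap.domain_sSup]
      refine sSup_le ?_
      rintro _ ⟨f, hf, rfl⟩
      exact ((hcS hf).2 i).resolve_left fun h' => h ⟨f, hf, h'⟩) f₀
    ⟨le_rfl, fun i => Or.inr le_sup_left⟩
  have key : ∀ i, F i ≤ m.domain ∧ ∀ x : m.domain, (x : M) ∈ F i → W i x (m x) := by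
    intro i
    induction i using WellFoundedLT.induction with
    | ind i ih =>
    by_contra hi
    have hle := (hm.prop.2 i).resolve_left hi
    -- At the first index missed by the maximal `m`, the domain is exactly the stage to which `step`
    -- applies, and the extension contradicts maximality.
    have hdom : m.domain = f₀.domain ⊔ filtrationBelow F i :=
      le_antisymm hle (sup_le hm.prop.1.1 (filtrationBelow_le fun j hj => (ih j hj).1))
    obtain ⟨g', hg, hg'dom, hW⟩ := step i m hdom hm.prop.1 fun j hj => (ih j hj).2
    have hg'S : g' ∈ S := by
      refine ⟨hm.prop.1.trans hg, fun k => ?_⟩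
      rcases lt_trichotomy i k with hk | rfl | hk
      · right
        rw [hg'dom, hdom]
        exact sup_le (sup_le le_sup_left ((filtrationBelow_le fun j hj =>
          le_filtrationBelow (hj.trans hk)).trans le_sup_right))
          ((le_filtrationBelow hk).trans le_sup_right)
      · exact Or.inl ⟨le_sup_right.trans hg'dom.ge, hW⟩
      · refine Or.inl ⟨(ih k hk).1.trans hg.1, fun x hx => ?_⟩
        have := (ih k hk).2 ⟨x, (ih k hk).1 hx⟩ hx
        rwa [hg.2 (x := ⟨x, (ih k hk).1 hx⟩) (y := x) rfl] at this
    have heq : g' = m := le_antisymm (hm.le_of_ge hg'S hg) hg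
    subst heq
    exact hi ⟨le_sup_right.trans hg'dom.ge, hW⟩
  have hmtop : ∀ x, x ∈ m.domain := fun x =>
    (htop.ge.trans (sup_le hm.prop.1.1 (iSup_le fun i => (key i).1))) Submodule.mem_top
  refine ⟨m.toFun ∘ₗ LinearMap.id.codRestrict m.domain hmtop, fun x => ?_, fun i x hx => ?_⟩
  · exact (hm.prop.1.2 (x := x) (y := ⟨x, hmtop x⟩) rfl).symm
  · exact (key i).2 ⟨x, hmtop x⟩ hx

end Filtration

/-- It suffices to test the vanishing of `Ext¹(C, X)` on one projective presentation of `C`. -/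
theorem ExtOneVanishes.of_projective {C X P : Type u} [AddCommGroup C] [Module R C]
    [AddCommGroup X] [Module R X] [AddCommGroup P] [Module R P] [Module.Projective R P]
    (p : P →ₗ[R] C) (hp : Function.Surjective p)
    (H : ∀ f : LinearMap.ker p →ₗ[R] X, ∃ h : P →ₗ[R] X, ∀ x : LinearMap.ker p, h x = f x) :
    ExtOneVanishes R C X := by
  intro B _ _ g hg f
  obtain ⟨l, hl⟩ := Module.projective_lifting_property g p hg
  have hl' : ∀ x, g (l x) = p x := fun x => LinearMap.congr_fun hl x
  obtain ⟨h, hh⟩ := H (f ∘ₗ (l.restrict (p := LinearMap.ker p) (q := LinearMap.ker g)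
    (fun x hx => by rw [LinearMap.mem_ker, hl']; exact hx)))
  -- Here `B = ker g + l(P)`, and `l x` lies in `ker g` exactly when `x` lies in `ker p`, where `h`
  -- agrees with `f ∘ l`.
  obtain ⟨g', hle, hdom, -⟩ := LinearPMap.exists_extension_sup_range
    (⟨LinearMap.ker g, f⟩ : B →ₗ.[R] X) l h (by
      intro x hx
      have hx' : p x = 0 := by rw [← hl' x]; exact hx
      exact hh ⟨x, hx'⟩)
  have htop : ∀ x, x ∈ g'.domain := by
    intro x
    obtain ⟨y, hy⟩ := hp (g x)
    rw [hdom]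
    refine Submodule.mem_sup.2 ⟨x - l y, ?_, l y, ⟨y, rfl⟩, by simp⟩
    change g (x - l y) = 0
    rw [map_sub, hl', hy, sub_self]
  refine ⟨g'.toFun ∘ₗ LinearMap.id.codRestrict g'.domain htop, fun x => ?_⟩
  exact (hle.2 (x := x) (y := ⟨x, htop x⟩) rfl).symm

/-- `M` has a well-ordered filtration whose successive quotients lie in `𝒞`. The quotient at `i`
is presented by a map `A → M` that covers the `i`-th step modulo the preceding ones. -/
def HasFiltration (𝒞 : ObjectProperty (ModuleCat.{u} R)) (M : Type u) [AddCommGroup M]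
    [Module R M] : Prop :=
  ∃ (ι : Type u) (_ : LinearOrder ι) (_ : WellFoundedLT ι) (F : ι → Submodule R M),
    Monotone F ∧ ⨆ i, F i = ⊤ ∧ ∀ i, ∃ (A C : ModuleCat.{u} R) (a : A →ₗ[R] M) (c : A →ₗ[R] C),
      𝒞 C ∧ filtrationBelow F i ⊔ LinearMap.range a = F i ∧ Function.Surjective c ∧
        ∀ x, c x = 0 ↔ a x ∈ filtrationBelow F i

/-- Eklof's lemma: vanishing of `Ext¹(-, X)` passes to filtered modules. -/
theorem HasFiltration.extOneVanishes {𝒞 : ObjectProperty (ModuleCat.{u} R)} {M X : Type u}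
    [AddCommGroup M] [Module R M] [AddCommGroup X] [Module R X] (hM : HasFiltration 𝒞 M)
    (h𝒞 : ∀ C : ModuleCat.{u} R, 𝒞 C → ExtOneVanishes R C X) : ExtOneVanishes R M X := by
  obtain ⟨ι, _, _, F, hF, htop, hstep⟩ := hM
  intro B _ _ g hg f
  let F' : ι → Submodule R B := fun i => (F i).comap g
  have hbelow : ∀ i, LinearMap.ker g ⊔ filtrationBelow F' i =
      (filtrationBelow F i).comap g := by
    intro i
    apply le_antisymm
    · refine sup_le (fun x hx => ?_) (filtrationBelow_le fun j hj =>
        Submodule.comap_mono (le_filtrationBelow hj))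
      rw [Submodule.mem_comap, LinearMap.mem_ker.1 hx]
      exact zero_mem _
    · intro x hx
      rcases mem_filtrationBelow hF (Submodule.mem_comap.1 hx) with h | ⟨j, hj, h⟩
      · exact Submodule.mem_sup_left h
      · exact Submodule.mem_sup_right (le_filtrationBelow (F := F') hj h)
  let f₀ : B →ₗ.[R] X := ⟨LinearMap.ker g, f⟩
  have hf₀ : ∀ i, f₀.domain ⊔ filtrationBelow F' i = (filtrationBelow F i).comap g := hbelow
  have htop' : f₀.domain ⊔ ⨆ i, F' i = ⊤ := by
    refine eq_top_iff.2 fun x _ => ?_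
    rcases mem_of_iSup_eq_top hF htop (g x) with h | ⟨i, h⟩
    · exact Submodule.mem_sup_left h
    · exact Submodule.mem_sup_right (Submodule.mem_iSup_of_mem (p := F') i h)
  obtain ⟨k, hk, -⟩ := exists_linearMap_of_filtration f₀ htop' (fun _ _ _ => True) (by
    intro i g₁ hg₁ _ _
    rw [hf₀] at hg₁
    obtain ⟨A, C, a, c, hC, hsup, hc, hac⟩ := hstep i
    -- The pullback of `A` and `B` over `M` maps onto `C`, and the kernel consists of the pairs
    -- whose `B`-component is already in the domain of `g₁`. Vanishing of `Ext¹(C, X)` thus extends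
    -- `g₁ ∘ b` to all of `D`.
    let D : Submodule R (A × B) :=
      LinearMap.eqLocus (a ∘ₗ LinearMap.fst R A B) (g ∘ₗ LinearMap.snd R A B)
    let q : D →ₗ[R] C := c ∘ₗ LinearMap.fst R A B ∘ₗ D.subtype
    let b : D →ₗ[R] B := LinearMap.snd R A B ∘ₗ D.subtype
    have hD : ∀ d : D, a d.1.1 = g (b d) := fun d => d.2
    have hqb : ∀ d, q d = 0 ↔ b d ∈ g₁.domain := by
      intro d
      rw [hg₁, Submodule.mem_comap, ← hD]
      exact hac _
    have hq : Function.Surjective q := by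
      intro y
      obtain ⟨x, rfl⟩ := hc y
      obtain ⟨z, hz⟩ := hg (a x)
      exact ⟨⟨(x, z), hz.symm⟩, rfl⟩
    obtain ⟨h, hh⟩ := h𝒞 C hC D q hq
      (g₁.toFun ∘ₗ b.restrict (p := LinearMap.ker q) (q := g₁.domain) fun d hd => (hqb d).1 hd)
    obtain ⟨g', hle, hdom, -⟩ := g₁.exists_extension_sup_range b h
      fun d hd => hh ⟨d, (hqb d).2 hd⟩
    refine ⟨g', hle, ?_, fun _ _ => trivial⟩
    rw [hdom, hg₁]
    apply le_antisymm
    · refine sup_le le_sup_left ?_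
      rintro _ ⟨d, rfl⟩
      refine Submodule.mem_sup_right ?_
      change g (b d) ∈ F i
      rw [← hD, ← hsup]
      exact Submodule.mem_sup_right ⟨_, rfl⟩
    · refine sup_le le_sup_left fun x hx => ?_
      have hx' : g x ∈ filtrationBelow F i ⊔ LinearMap.range a := hsup ▸ hx
      obtain ⟨y, hy, _, ⟨z, rfl⟩, hyz⟩ := Submodule.mem_sup.1 hx'
      obtain ⟨w, hw⟩ := hg (a z)
      refine Submodule.mem_sup.2 ⟨x - w, ?_, w, ⟨⟨(z, w), hw.symm⟩, rfl⟩, by simp⟩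
      rw [Submodule.mem_comap, map_sub, hw, ← hyz, add_sub_cancel_right]
      exact hy)
  exact ⟨k, hk⟩

end Extension

/-! ### Filtration of a direct sum by support. -/

section DirectSumFiltration

variable {R : Type u} [Ring R] {ι : Type*} [LinearOrder ι] {Q : ι → Type*}
  [∀ i, AddCommGroup (Q i)] [∀ i, Module R (Q i)]

variable (R Q) in
/-- The elements of the direct sum that vanish beyond the index `i`. -/
def dfinsuppLE (i : ι) : Submodule R (Π₀ i, Q i) :=
  ⨅ j, ⨅ _ : i < j, LinearMap.ker (DFinsupp.lapply (R := R) j)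

theorem mem_dfinsuppLE {i : ι} {x : Π₀ i, Q i} : x ∈ dfinsuppLE R Q i ↔ ∀ j, i < j → x j = 0 := by
  simp [dfinsuppLE, Submodule.mem_iInf]

theorem dfinsuppLE_mono : Monotone (dfinsuppLE R Q) := fun _ _ hij _ hx =>
  mem_dfinsuppLE.2 fun k hk => mem_dfinsuppLE.1 hx k (hij.trans_lt hk)

variable (R Q) in
theorem single_mem_dfinsuppLE {i : ι} (y : Q i) : DFinsupp.single i y ∈ dfinsuppLE R Q i :=
  mem_dfinsuppLE.2 fun _ hj => DFinsupp.single_eq_of_ne hj.ne'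

open Classical in
-- The index is the largest element of the finite support.
theorem exists_mem_dfinsuppLE (x : Π₀ i, Q i) :
    x = 0 ∨ ∃ i, x i ≠ 0 ∧ x ∈ dfinsuppLE R Q i := by
  by_cases hx : x = 0
  · exact Or.inl hx
  · have hne : x.support.Nonempty := by
      rwa [Finset.nonempty_iff_ne_empty, Ne, DFinsupp.support_eq_empty]
    refine Or.inr ⟨x.support.max' hne, DFinsupp.mem_support_iff.1 (Finset.max'_mem _ _),
      mem_dfinsuppLE.2 fun j hj => ?_⟩
    by_contra h
    exact (x.support.le_max' j (DFinsupp.mem_support_iff.2 h)).not_gt hj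

end DirectSumFiltration

/-! ### Filtered kernels and cokernels of maps to and from projectives. -/

section Syzygies

variable {R : Type u} [Ring R]

/-- The horseshoe lemma for filtrations: projective presentations of the successive quotients
assemble to a projective presentation whose kernel is filtered by the kernels. -/
theorem HasFiltration.exists_projective_cover {𝒞 𝒟 : ObjectProperty (ModuleCat.{u} R)} {M : Type u}
    [AddCommGroup M] [Module R M] (hM : HasFiltration 𝒞 M)
    (h𝒞 : ∀ C : ModuleCat.{u} R, 𝒞 C → ∃ (P : ModuleCat.{u} R) (p : P →ₗ[R] C),
      Module.Projective R P ∧ Function.Surjective p ∧ 𝒟 (ModuleCat.of R (LinearMap.ker p))) :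
    ∃ (P : ModuleCat.{u} R) (p : P →ₗ[R] M),
      Module.Projective R P ∧ Function.Surjective p ∧ HasFiltration 𝒟 (LinearMap.ker p) := by
  classical
  obtain ⟨ι, _, _, F, hF, htop, hstep⟩ := hM
  have hstep' : ∀ i, ∃ (P C : ModuleCat.{u} R) (q : P →ₗ[R] M) (p : P →ₗ[R] C),
      Module.Projective R P ∧ 𝒟 (ModuleCat.of R (LinearMap.ker p)) ∧
      filtrationBelow F i ⊔ LinearMap.range q = F i ∧
        ∀ x, p x = 0 ↔ q x ∈ filtrationBelow F i := by
    intro i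
    obtain ⟨A, C, a, c, hC, hsup, hc, hac⟩ := hstep i
    obtain ⟨P, p, hP, hp, hK⟩ := h𝒞 C hC
    obtain ⟨l, hl⟩ := Module.projective_lifting_property c p hc
    have hl' : ∀ x, c (l x) = p x := fun x => LinearMap.congr_fun hl x
    refine ⟨P, C, a ∘ₗ l, p, hP, hK, ?_, fun x => by rw [← hl']; exact hac _⟩
    apply le_antisymm
    · rw [← hsup]
      exact sup_le_sup_left (LinearMap.range_comp_le_range _ _) _
    · rw [← hsup]
      refine sup_le le_sup_left ?_
      rintro _ ⟨x, rfl⟩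
      obtain ⟨y, hy⟩ := hp (c x)
      refine Submodule.mem_sup.2 ⟨a (x - l y), ?_, a (l y), ⟨y, rfl⟩, by simp⟩
      rw [← hac, map_sub, hl', hy, sub_self]
  choose P C q p hP hK hsup hpq using hstep'
  let φ : (Π₀ i, P i) →ₗ[R] M := DFinsupp.lsum ℕ q
  have hφs : ∀ i y, φ (DFinsupp.single i y) = q i y := fun i y => DFinsupp.lsum_single ℕ q i y
  have hqF : ∀ i y, q i y ∈ F i := fun i y => hsup i ▸ Submodule.mem_sup_right ⟨y, rfl⟩
  have hφ : ∀ (N : Submodule R M) (x : Π₀ i, P i), (∀ i, q i (x i) ∈ N) → φ x ∈ N := by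
    intro N x hx
    rw [DFinsupp.lsum_apply_apply, DFinsupp.sumAddHom_apply]
    exact Submodule.sum_mem _ fun i _ => hx i
  -- Not just surjectivity: elements of `F i` have preimages supported on indices at most `i`, which
  -- is what later identifies the quotients of the kernel filtration.
  have hcover : ∀ i, F i ≤ (dfinsuppLE R (fun i => P i) i).map φ := by
    intro i
    induction i using WellFoundedLT.induction with
    | ind i ih =>
    rw [← hsup i]
    refine sup_le (filtrationBelow_le fun j hj => (ih j hj).trans
      (Submodule.map_mono (dfinsuppLE_mono hj.le))) ?_
    rintro _ ⟨y, rfl⟩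
    exact ⟨DFinsupp.single i y, single_mem_dfinsuppLE R (fun i => P i) y, hφs i y⟩
  refine ⟨ModuleCat.of R (Π₀ i, P i), φ, inferInstanceAs (Module.Projective R (Π₀ i, P i)), ?_, ?_⟩
  · intro x
    rcases mem_of_iSup_eq_top hF htop x with rfl | ⟨i, hi⟩
    · exact ⟨0, map_zero _⟩
    · obtain ⟨y, -, hy⟩ := hcover i hi
      exact ⟨y, hy⟩
  -- The kernel is filtered by support; the `i`-th coordinate will identify the `i`-th quotient with
  -- `ker (p i)`.
  let K : ι → Submodule R (LinearMap.ker φ) := fun i =>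
    (dfinsuppLE R (fun i => P i) i).comap (LinearMap.ker φ).subtype
  have hKmono : Monotone K := fun i j hij => Submodule.comap_mono (dfinsuppLE_mono hij)
  have hle : ∀ i, filtrationBelow K i ≤ K i := fun i =>
    filtrationBelow_le fun j hj => hKmono hj.le
  have hpK : ∀ i, ∀ x : LinearMap.ker φ, x ∈ K i → p i (x.1 i) = 0 := by
    intro i x hx
    rw [hpq]
    -- Without its top coordinate `x` maps below stage `i`; as `φ x = 0`, the top coordinate does
    -- too.
    have h1 : φ (x.1 - DFinsupp.single i (x.1 i)) ∈ filtrationBelow F i := by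
      refine hφ _ _ fun j => ?_
      rcases lt_trichotomy j i with h | rfl | h
      · exact le_filtrationBelow h (hqF _ _)
      · simp
      · have hxj : x.1 j = 0 := mem_dfinsuppLE.1 hx j h
        rw [DFinsupp.sub_apply, hxj, DFinsupp.single_eq_of_ne h.ne']
        simp
    rw [map_sub, LinearMap.mem_ker.1 x.2, zero_sub, hφs] at h1
    simpa using h1
  refine ⟨ι, inferInstance, inferInstance, K, hKmono, ?_, fun i => ?_⟩
  · refine eq_top_iff.2 fun x _ => ?_
    rcases exists_mem_dfinsuppLE (R := R) x.1 with h | ⟨i, -, h⟩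
    · rw [show x = 0 from Subtype.ext h]
      exact zero_mem _
    · exact Submodule.mem_iSup_of_mem (p := K) i h
  · let π : K i →ₗ[R] LinearMap.ker (p i) :=
      ((DFinsupp.lapply i) ∘ₗ (LinearMap.ker φ).subtype ∘ₗ (K i).subtype).codRestrict _
        fun x => hpK i x.1 x.2
    refine ⟨ModuleCat.of R (K i), ModuleCat.of R (LinearMap.ker (p i)), (K i).subtype, π, hK i,
      ?_, ?_, ?_⟩
    · rw [Submodule.range_subtype]
      exact sup_eq_right.2 (hle i)
    · rintro ⟨y, hy⟩
      have hy' := (hpq i y).1 hy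
      -- Correcting `single i y` by such a `z` puts it in `ker φ` without changing the `i`-th
      -- coordinate.
      have : ∃ z : Π₀ i, P i, φ z = q i y ∧ ∀ j, i ≤ j → z j = 0 := by
        rcases mem_filtrationBelow hF hy' with h | ⟨j, hj, h⟩
        · exact ⟨0, by rw [h, map_zero], fun _ _ => rfl⟩
        · obtain ⟨z, hz, hz'⟩ := hcover j h
          exact ⟨z, hz', fun k hk => mem_dfinsuppLE.1 hz k (hj.trans_le hk)⟩
      obtain ⟨z, hz, hz0⟩ := this
      refine ⟨⟨⟨DFinsupp.single i y - z, ?_⟩, ?_⟩, ?_⟩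
      · rw [LinearMap.mem_ker, map_sub, hφs, hz, sub_self]
      · exact sub_mem (single_mem_dfinsuppLE R (fun i => P i) y) (mem_dfinsuppLE.2 fun j hj => hz0 j hj.le)
      · apply Subtype.ext
        change (DFinsupp.single i y - z : Π₀ i, P i) i = y
        rw [DFinsupp.sub_apply, hz0 i le_rfl, DFinsupp.single_eq_same, sub_zero]
    · intro x
      have h1 : π x = 0 ↔ x.1.1 i = 0 := Subtype.ext_iff
      rw [h1]
      constructor
      · intro hx
        rcases exists_mem_dfinsuppLE (R := R) x.1.1 with h | ⟨j, hj0, hj⟩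
        · change x.1 ∈ _
          rw [show x.1 = 0 from Subtype.ext h]
          exact zero_mem _
        · have hji : j < i := by
            rcases lt_trichotomy j i with h | rfl | h
            · exact h
            · exact (hj0 hx).elim
            · exact (hj0 (mem_dfinsuppLE.1 x.2 j h)).elim
          exact le_filtrationBelow (F := K) hji hj
      · intro hx
        have h2 : filtrationBelow K i ≤
            LinearMap.ker (DFinsupp.lapply (R := R) i ∘ₗ (LinearMap.ker φ).subtype) :=
          filtrationBelow_le fun j hj y hy => mem_dfinsuppLE.1 hy i hj
        exact h2 hx

/-- Embeddings of the successive quotients into projective modules assemble to an embedding into a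
projective module whose cokernel is filtered by the cokernels. -/
theorem HasFiltration.exists_projective_embedding {𝒢 : ObjectProperty (ModuleCat.{u} R)}
    {M : Type u} [AddCommGroup M] [Module R M] (hM : HasFiltration 𝒢 M)
    (h𝒢 : ∀ C : ModuleCat.{u} R, 𝒢 C → ∃ (Q : ModuleCat.{u} R) (j : C →ₗ[R] Q),
      Module.Projective R Q ∧ Function.Injective j ∧ 𝒢 (ModuleCat.of R (Q ⧸ LinearMap.range j)))
    (hext : ∀ C : ModuleCat.{u} R, 𝒢 C → ∀ X : ModuleCat.{u} R, Module.Projective R X →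
      ExtOneVanishes R C X) :
    ∃ (Q : ModuleCat.{u} R) (j : M →ₗ[R] Q),
      Module.Projective R Q ∧ Function.Injective j ∧ HasFiltration 𝒢 (Q ⧸ LinearMap.range j) := by
  classical
  obtain ⟨ι, _, _, F, hF, htop, hstep⟩ := hM
  choose A C a c hC hsup hc hac using hstep
  choose Q j hQ hj hcoker using fun i => h𝒢 (C i) (hC i)
  have haF : ∀ i z, a i z ∈ F i := fun i z => hsup i ▸ Submodule.mem_sup_right ⟨z, rfl⟩
  -- Triangularity: on `F i` the map to be built has support at most `i`, with leading coordinate `j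
  -- i` of the class of `x` in `C i`.
  let W : ι → M → (Π₀ i, Q i) → Prop := fun i x y =>
    (∀ k, i < k → y k = 0) ∧ ∀ z, x - a i z ∈ filtrationBelow F i → y i = j i (c i z)
  have hproj : Module.Projective R (Π₀ i, Q i) := inferInstance
  obtain ⟨φ, -, hφ⟩ := exists_linearMap_of_filtration (F := F) (⊥ : M →ₗ.[R] (Π₀ i, Q i))
      (by rw [htop, sup_top_eq]) W (by
    intro i g hg _ hgW
    have hg' : g.domain = filtrationBelow F i := hg.trans (bot_sup_eq _)
    have hlow : ∀ (x : g.domain) (k : ι), i ≤ k → g x k = 0 := by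
      intro x k hk
      rcases mem_filtrationBelow hF (hg' ▸ x.2 : (x : M) ∈ filtrationBelow F i) with h | ⟨l, hl, h⟩
      · rw [show x = 0 from Subtype.ext h, LinearPMap.map_zero, DFinsupp.zero_apply]
      · exact (hgW l hl x h).1 k (hl.trans_le hk)
    have hmem : ∀ z, c i z = 0 ↔ a i z ∈ g.domain := fun z => by rw [hg', hac]
    obtain ⟨h, hh⟩ := hext (C i) (hC i) (ModuleCat.of R (Π₀ i, Q i)) hproj (A i) (c i) (hc i)
      (g.toFun ∘ₗ (a i).restrict (p := LinearMap.ker (c i)) (q := g.domain)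
        fun z hz => (hmem z).1 hz)
    -- The extension `h` given by `Ext¹` vanishing is uncontrolled in coordinates at least `i`.
    -- These are discarded and `j i ∘ c i` is put at `i`; on `ker (c i)` nothing changes, because
    -- there `h` equals `g ∘ a i`, supported below `i`.
    let h' : A i →ₗ[R] Π₀ i, Q i :=
      DFinsupp.filterLinearMap R (fun i => Q i) (· < i) ∘ₗ h + DFinsupp.lsingle i ∘ₗ j i ∘ₗ c i
    have hlt : ∀ z k, k < i → h' z k = h z k := by
      intro z k hk
      change (DFinsupp.filter (· < i) (h z) + DFinsupp.single i (j i (c i z)) : Π₀ i, Q i) k = h z k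
      rw [DFinsupp.add_apply, DFinsupp.filter_apply_pos (p := (· < i)) _ hk, DFinsupp.single_eq_of_ne hk.ne,
        add_zero]
    have heq : ∀ z, h' z i = j i (c i z) := by
      intro z
      change (DFinsupp.filter (· < i) (h z) + DFinsupp.single i (j i (c i z)) : Π₀ i, Q i) i = _
      rw [DFinsupp.add_apply, DFinsupp.filter_apply_neg (p := (· < i)) _ (lt_irrefl i),
        DFinsupp.single_eq_same, zero_add]
    have hgt : ∀ z k, i < k → h' z k = 0 := by
      intro z k hk
      change (DFinsupp.filter (· < i) (h z) + DFinsupp.single i (j i (c i z)) : Π₀ i, Q i) k = 0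
      rw [DFinsupp.add_apply, DFinsupp.filter_apply_neg (p := (· < i)) _ hk.not_gt,
        DFinsupp.single_eq_of_ne hk.ne', add_zero]
    obtain ⟨g', hle, hdom, hg'h⟩ := g.exists_extension_sup_range (a i) h' (by
      intro z hz
      have hz' : h z = g ⟨a i z, hz⟩ := hh ⟨z, (hmem z).2 hz⟩
      ext1 k
      rcases lt_trichotomy k i with hk | rfl | hk
      · rw [hlt z k hk, hz']
      · rw [heq, hlow _ _ le_rfl, (hmem z).2 hz, map_zero]
      · rw [hgt z k hk, hlow _ _ hk.le])
    refine ⟨g', hle, ?_, ?_⟩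
    · rw [hdom, hg', hsup, eq_comm, sup_eq_right]
      exact filtrationBelow_le fun j hj => hF hj.le
    · intro x hx
      have hdecomp : ∀ z, (x : M) - a i z ∈ filtrationBelow F i → ∀ k, i ≤ k →
          g' x k = h' z k := by
        intro z hz k hk
        have hz1 : (x : M) - a i z ∈ g.domain := hg' ▸ hz
        have hz2 : a i z ∈ g'.domain := hdom ▸ Submodule.mem_sup_right ⟨z, rfl⟩
        have hxz : x = (⟨(x : M) - a i z, hle.1 hz1⟩ : g'.domain) + ⟨a i z, hz2⟩ :=
          Subtype.ext (sub_add_cancel _ _).symm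
        rw [hxz, LinearPMap.map_add, hg'h, ← hle.2 (x := ⟨_, hz1⟩) rfl, DFinsupp.add_apply,
          hlow _ _ hk, zero_add]
      refine ⟨fun k hk => ?_, fun z hz => by rw [hdecomp z hz i le_rfl, heq]⟩
      rw [← hsup i] at hx
      obtain ⟨y, hy, _, ⟨z, rfl⟩, hyz⟩ := Submodule.mem_sup.1 hx
      rw [hdecomp z (by rw [← hyz, add_sub_cancel_right]; exact hy) k hk.le, hgt z k hk])
  have hφlow : ∀ i, ∀ x ∈ F i, φ x i = 0 → x ∈ filtrationBelow F i := by
    intro i x hx h0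
    have hx' := hx
    rw [← hsup i] at hx'
    obtain ⟨y, hy, _, ⟨z, rfl⟩, rfl⟩ := Submodule.mem_sup.1 hx'
    have h1 := (hφ i _ hx).2 z (by rwa [add_sub_cancel_right])
    rw [h0] at h1
    refine add_mem hy ((hac i z).1 (hj i ?_))
    rw [← h1, map_zero]
  -- Strictness of `φ` for the two filtrations: at the first stage containing `x`, the corresponding
  -- coordinate of `φ x` cannot vanish.
  have hφF : ∀ i x, φ x ∈ dfinsuppLE R (fun i => Q i) i → x ∈ F i := by
    intro i x hx
    by_cases h0 : x = 0
    · rw [h0]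
      exact zero_mem _
    · obtain ⟨k, hk, hk'⟩ := exists_mem_notMem_filtrationBelow hF htop h0
      rcases le_or_gt k i with hki | hki
      · exact hF hki hk
      · exact (hk' (hφlow k x hk (mem_dfinsuppLE.1 hx k hki))).elim
  refine ⟨ModuleCat.of R (Π₀ i, Q i), φ, hproj, ?_, ?_⟩
  · refine (injective_iff_map_eq_zero φ).2 fun x hx => ?_
    by_contra h0
    obtain ⟨k, hk, hk'⟩ := exists_mem_notMem_filtrationBelow hF htop h0
    exact hk' (hφlow k x hk (by rw [hx, DFinsupp.zero_apply]))
  change HasFiltration 𝒢 ((Π₀ i, Q i) ⧸ LinearMap.range φ)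
  let L : ι → Submodule R ((Π₀ i, Q i) ⧸ LinearMap.range φ) := fun i =>
    (dfinsuppLE R (fun i => Q i) i).map (LinearMap.range φ).mkQ
  have hL : Monotone L := fun i k hik => Submodule.map_mono (dfinsuppLE_mono hik)
  have hLbelow : ∀ i (w : Π₀ i, Q i), (∀ k, i ≤ k → w k = 0) →
      (LinearMap.range φ).mkQ w ∈ filtrationBelow L i := by
    intro i w hw
    rcases exists_mem_dfinsuppLE (R := R) w with rfl | ⟨k, hk0, hk⟩
    · rw [map_zero]
      exact zero_mem _
    · exact le_filtrationBelow (F := L) (lt_of_not_ge fun h => hk0 (hw k h)) ⟨w, hk, rfl⟩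
  refine ⟨ι, inferInstance, inferInstance, L, hL, ?_, fun i => ?_⟩
  · refine eq_top_iff.2 fun x _ => ?_
    obtain ⟨w, rfl⟩ := (LinearMap.range φ).mkQ_surjective x
    rcases exists_mem_dfinsuppLE (R := R) w with rfl | ⟨k, -, hk⟩
    · rw [map_zero]
      exact zero_mem _
    · exact Submodule.mem_iSup_of_mem (p := L) k ⟨w, hk, rfl⟩
  refine ⟨Q i, ModuleCat.of R (Q i ⧸ LinearMap.range (j i)),
    (LinearMap.range φ).mkQ ∘ₗ DFinsupp.lsingle (M := fun i => Q i) i, (LinearMap.range (j i)).mkQ, hcoker i, ?_,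
    (LinearMap.range (j i)).mkQ_surjective, fun y => ?_⟩
  · apply le_antisymm
    · refine sup_le (filtrationBelow_le fun k hk => hL hk.le) ?_
      rintro _ ⟨y, rfl⟩
      exact ⟨_, single_mem_dfinsuppLE R (fun i => Q i) y, rfl⟩
    · rintro _ ⟨w, hw, rfl⟩
      refine Submodule.mem_sup.2 ⟨(LinearMap.range φ).mkQ (w - DFinsupp.single i (w i)),
        hLbelow i _ fun k hk => ?_, (LinearMap.range φ).mkQ (DFinsupp.single i (w i)),
        ⟨w i, rfl⟩, by rw [← map_add, sub_add_cancel]⟩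
      rcases hk.eq_or_lt with rfl | hk
      · simp
      · rw [DFinsupp.sub_apply, mem_dfinsuppLE.1 hw k hk, DFinsupp.single_eq_of_ne hk.ne', sub_zero]
  · change (LinearMap.range (j i)).mkQ y = 0 ↔
      (LinearMap.range φ).mkQ (DFinsupp.single i y) ∈ filtrationBelow L i
    rw [Submodule.mkQ_apply, Submodule.Quotient.mk_eq_zero]
    constructor
    -- Modulo `φ (a i z)`, which has leading coordinate `j i (c i z)`, the single term becomes an
    -- element supported below `i`.
    · rintro ⟨v, rfl⟩
      obtain ⟨z, rfl⟩ := hc i v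
      have h1 := hφ i (a i z) (haF i z)
      have h2 := hLbelow i (DFinsupp.single i (j i (c i z)) - φ (a i z)) (by
        intro k hk
        rcases hk.eq_or_lt with rfl | hk
        · rw [DFinsupp.sub_apply, h1.2 z (by rw [sub_self]; exact zero_mem _),
            DFinsupp.single_eq_same, sub_self]
        · rw [DFinsupp.sub_apply, h1.1 k hk, DFinsupp.single_eq_of_ne hk.ne', sub_zero])
      have h3 : (LinearMap.range φ).mkQ (φ (a i z)) = 0 :=
        (Submodule.Quotient.mk_eq_zero _).2 ⟨_, rfl⟩
      rwa [map_sub, h3, sub_zero] at h2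
    · intro hy
      obtain ⟨w, hw, hw0⟩ : ∃ w : Π₀ i, Q i, (LinearMap.range φ).mkQ w =
          (LinearMap.range φ).mkQ (DFinsupp.single i y) ∧ ∀ k, i ≤ k → w k = 0 := by
        rcases mem_filtrationBelow hL hy with h | ⟨k, hk, w, hw, hwy⟩
        · exact ⟨0, by rw [h, map_zero], fun _ _ => rfl⟩
        · exact ⟨w, hwy, fun l hl => mem_dfinsuppLE.1 hw l (hk.trans_le hl)⟩
      -- By strictness this `x` lies in `F i`, so the `i`-th coordinate `y` of `φ x` is in the range
      -- of `j i`.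
      obtain ⟨x, hx⟩ := (Submodule.Quotient.eq _).1 hw.symm
      have hxF : x ∈ F i := hφF i x (by
        rw [hx]
        exact sub_mem (single_mem_dfinsuppLE R (fun i => Q i) y)
          (mem_dfinsuppLE.2 fun k hk => hw0 k hk.le))
      have hxF' := hxF
      rw [← hsup i] at hxF'
      obtain ⟨v, hv, _, ⟨z, rfl⟩, rfl⟩ := Submodule.mem_sup.1 hxF'
      have h1 := (hφ i _ hxF).2 z (by rwa [add_sub_cancel_right])
      rw [hx, DFinsupp.sub_apply, hw0 i le_rfl, DFinsupp.single_eq_same, sub_zero] at h1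
      exact ⟨c i z, h1.symm⟩

end Syzygies

/-! ### Shifting complete resolutions. -/

namespace TwoSidedSequence

variable {R : Type u} [Ring R]

/-- The sequence re-indexed so that its middle map is `P_1 → P_0`. -/
def shiftLeft (P : TwoSidedSequence R) : TwoSidedSequence R where
  left n := P.left (n + 1)
  right
    | 0 => P.left 0
    | n + 1 => P.right n
  dLeft n := P.dLeft (n + 1)
  mid := P.dLeft 0
  dRight
    | 0 => P.mid
    | n + 1 => P.dRight n

/-- The sequence re-indexed so that its middle map is `P^0 → P^1`. -/
def shiftRight (P : TwoSidedSequence R) : TwoSidedSequence R where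
  left
    | 0 => P.right 0
    | n + 1 => P.left n
  right n := P.right (n + 1)
  dLeft
    | 0 => P.mid
    | n + 1 => P.dLeft n
  mid := P.dRight 0
  dRight n := P.dRight (n + 1)

theorem IsCompleteProjective.shiftLeft {𝔛 : ObjectProperty (ModuleCat.{u} R)}
    {P : TwoSidedSequence R} (h : P.IsCompleteProjective 𝔛) :
    P.shiftLeft.IsCompleteProjective 𝔛 where
  projective_left n := h.projective_left (n + 1)
  projective_right
    | 0 => h.projective_left 0
    | n + 1 => h.projective_right n
  exact :=
    { left_succ := fun n => h.exact.left_succ (n + 1)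
      left_zero := h.exact.left_succ 0
      right_zero := h.exact.left_zero
      right_succ := fun
        | 0 => h.exact.right_zero
        | n + 1 => h.exact.right_succ n }
  hom_exact X hX :=
    { left_succ := fun n => (h.hom_exact X hX).left_succ (n + 1)
      left_zero := (h.hom_exact X hX).left_succ 0
      right_zero := (h.hom_exact X hX).left_zero
      right_succ := fun
        | 0 => (h.hom_exact X hX).right_zero
        | n + 1 => (h.hom_exact X hX).right_succ n }

theorem IsCompleteProjective.shiftRight {𝔛 : ObjectProperty (ModuleCat.{u} R)}
    {P : TwoSidedSequence R} (h : P.IsCompleteProjective 𝔛) :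
    P.shiftRight.IsCompleteProjective 𝔛 where
  projective_left
    | 0 => h.projective_right 0
    | n + 1 => h.projective_left n
  projective_right n := h.projective_right (n + 1)
  exact :=
    { left_succ := fun
        | 0 => h.exact.left_zero
        | n + 1 => h.exact.left_succ n
      left_zero := h.exact.right_zero
      right_zero := h.exact.right_succ 0
      right_succ := fun n => h.exact.right_succ (n + 1) }
  hom_exact X hX :=
    { left_succ := fun
        | 0 => (h.hom_exact X hX).left_zero
        | n + 1 => (h.hom_exact X hX).left_succ n
      left_zero := (h.hom_exact X hX).right_zero
      right_zero := (h.hom_exact X hX).right_succ 0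
      right_succ := fun n => (h.hom_exact X hX).right_succ (n + 1) }

/-- The map `P_1 → P_0` induces a presentation of the kernel of `P_0 → P^0`. -/
theorem IsExact.exists_cover {P : TwoSidedSequence R} (h : P.IsExact) {G : Type*} [AddCommGroup G]
    [Module R G] (e : G ≃ₗ[R] LinearMap.ker P.mid.hom) :
    ∃ p : P.left 1 →ₗ[R] G, Function.Surjective p ∧
      LinearMap.ker p = LinearMap.ker (P.dLeft 0).hom := by
  refine ⟨e.symm.toLinearMap ∘ₗ
    (P.dLeft 0).hom.codRestrict _ fun x => (h.left_zero _).2 ⟨x, rfl⟩,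
    e.symm.surjective.comp ?_, ?_⟩
  · rintro ⟨y, hy⟩
    obtain ⟨x, hx⟩ := (h.left_zero y).1 hy
    exact ⟨x, Subtype.ext hx⟩
  · rw [LinearEquiv.ker_comp]
    exact LinearMap.ker_codRestrict _ _ _

end TwoSidedSequence

/-! ### Covers, embeddings and `Ext¹` for `𝔛`-Gorenstein projectives. -/

section XGorensteinProjective

variable {R : Type u} [Ring R] {𝔛 : ObjectProperty (ModuleCat.{u} R)}

theorem IsXGorensteinProjective.of_linearEquiv {G G' : ModuleCat.{u} R}
    (hG : IsXGorensteinProjective 𝔛 G) (e : G ≃ₗ[R] G') : IsXGorensteinProjective 𝔛 G' := by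
  obtain ⟨P, hP, ⟨f⟩⟩ := hG
  exact ⟨P, hP, ⟨e.symm.trans f⟩⟩

/-- `P_1` covers `G`, and the kernel of the cover is the middle kernel of the left-shifted
resolution. -/
theorem IsXGorensteinProjective.exists_projective_cover {G : ModuleCat.{u} R}
    (hG : IsXGorensteinProjective 𝔛 G) :
    ∃ (P : ModuleCat.{u} R) (p : P →ₗ[R] G), Module.Projective R P ∧ Function.Surjective p ∧
      IsXGorensteinProjective 𝔛 (ModuleCat.of R (LinearMap.ker p)) := by
  obtain ⟨P, hP, ⟨e⟩⟩ := hG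
  obtain ⟨p, hp, hker⟩ := hP.exact.exists_cover e
  exact ⟨P.left 1, p, hP.projective_left 1, hp, P.shiftLeft, hP.shiftLeft,
    ⟨LinearEquiv.ofEq _ _ hker⟩⟩

/-- `G` embeds in `P_0`, and the cokernel is the image of `P_0 → P^0`, which is the middle kernel of
the right-shifted resolution. -/
theorem IsXGorensteinProjective.exists_projective_embedding {G : ModuleCat.{u} R}
    (hG : IsXGorensteinProjective 𝔛 G) :
    ∃ (Q : ModuleCat.{u} R) (j : G →ₗ[R] Q), Module.Projective R Q ∧ Function.Injective j ∧
      IsXGorensteinProjective 𝔛 (ModuleCat.of R (Q ⧸ LinearMap.range j)) := by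
  obtain ⟨P, hP, ⟨e⟩⟩ := hG
  have hrange : LinearMap.range ((LinearMap.ker P.mid.hom).subtype ∘ₗ e.toLinearMap) =
      LinearMap.ker P.mid.hom := by
    rw [LinearEquiv.range_comp, Submodule.range_subtype]
  refine ⟨P.left 0, (LinearMap.ker P.mid.hom).subtype ∘ₗ e.toLinearMap, hP.projective_left 0,
    Subtype.val_injective.comp e.injective, P.shiftRight, hP.shiftRight,
    ⟨(Submodule.quotEquivOfEq _ _ hrange).trans
      (P.mid.hom.quotKerEquivRange.trans (LinearEquiv.ofEq _ _ ?_))⟩⟩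
  exact (LinearMap.exact_iff.1 hP.exact.right_zero).symm

/-- A map from the kernel of `P_1 → G` to `X`, composed with `P_2` onto that kernel, is a cocycle;
exactness of `Hom(-, X)` at `P_2` extends it to `P_1`. -/
theorem IsXGorensteinProjective.extOneVanishes {G X : ModuleCat.{u} R}
    (hG : IsXGorensteinProjective 𝔛 G) (hX : 𝔛 X) : ExtOneVanishes R G X := by
  obtain ⟨P, hP, ⟨e⟩⟩ := hG
  obtain ⟨p, hp, hker⟩ := hP.exact.exists_cover e
  have := hP.projective_left 1
  refine ExtOneVanishes.of_projective p hp fun f => ?_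
  have hd : ∀ x, (P.dLeft 1).hom x ∈ LinearMap.ker p := fun x => by
    rw [hker]
    exact (hP.exact.left_succ 0 _).2 ⟨x, rfl⟩
  let k : P.left 2 ⟶ X := ModuleCat.ofHom (f ∘ₗ (P.dLeft 1).hom.codRestrict _ hd)
  have hk : P.dLeft 2 ≫ k = 0 := by
    ext x
    have h0 : (P.dLeft 1).hom ((P.dLeft 2).hom x) = 0 := (hP.exact.left_succ 1 _).2 ⟨x, rfl⟩
    change f ⟨(P.dLeft 1).hom ((P.dLeft 2).hom x), _⟩ = 0
    rw [show (⟨(P.dLeft 1).hom ((P.dLeft 2).hom x), hd _⟩ :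
      LinearMap.ker p) = 0 from Subtype.ext h0, map_zero]
  obtain ⟨h, hh⟩ := ((hP.hom_exact X hX).left_succ 1 k).1 hk
  refine ⟨h.hom, fun x => ?_⟩
  obtain ⟨y, hy⟩ := (hP.exact.left_succ 0 x.1).1 (hker ▸ x.2 : x.1 ∈ LinearMap.ker (P.dLeft 0).hom)
  have h1 : h.hom ((P.dLeft 1).hom y) = f ⟨(P.dLeft 1).hom y, hd y⟩ :=
    LinearMap.congr_fun (congrArg ModuleCat.Hom.hom hh) y
  rw [← hy, h1]
  exact congrArg f (Subtype.ext hy)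

end XGorensteinProjective

/-! ### Splicing short exact sequences. -/

section Splicing

variable {R : Type u} [Ring R]

theorem Function.Exact.comp_surjective_injective {A Z B Z' D : Type*} [AddCommGroup A]
    [Module R A] [AddCommGroup Z] [Module R Z] [AddCommGroup B] [Module R B] [AddCommGroup Z']
    [Module R Z'] [AddCommGroup D] [Module R D] {p : A →ₗ[R] Z} (hp : Function.Surjective p)
    {i : Z →ₗ[R] B} {q : B →ₗ[R] Z'} (hiq : Function.Exact i q) {j : Z' →ₗ[R] D}
    (hj : Function.Injective j) : Function.Exact (i ∘ₗ p) (j ∘ₗ q) := by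
  intro x
  rw [LinearMap.comp_apply, map_eq_zero_iff j hj, hiq x]
  constructor
  · rintro ⟨y, rfl⟩
    obtain ⟨z, rfl⟩ := hp y
    exact ⟨z, rfl⟩
  · rintro ⟨z, rfl⟩
    exact ⟨p z, rfl⟩

/-- Exactness of `Hom(-, X)` at `B`, for two spliced short exact sequences the second of which
has the extension property with respect to `X`. -/
theorem exact_precomp_of_extends {A Z B Z' D X : ModuleCat.{u} R} {p : A →ₗ[R] Z}
    (hp : Function.Surjective p) {i : Z →ₗ[R] B} {q : B →ₗ[R] Z'} (hq : Function.Surjective q)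
    (hiq : Function.Exact i q) {j : Z' →ₗ[R] D}
    (hj : ∀ f : Z' →ₗ[R] X, ∃ h : D →ₗ[R] X, h ∘ₗ j = f) :
    Function.Exact (fun f : D ⟶ X => ModuleCat.ofHom (j ∘ₗ q) ≫ f)
      (fun f : B ⟶ X => ModuleCat.ofHom (i ∘ₗ p) ≫ f) := by
  intro f
  constructor
  · intro hf
    have hfi : ∀ z, f.hom (i z) = 0 := by
      intro z
      obtain ⟨a, rfl⟩ := hp z
      exact LinearMap.congr_fun (congrArg ModuleCat.Hom.hom hf) a
    have hker : LinearMap.ker q ≤ LinearMap.ker f.hom := by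
      intro x hx
      obtain ⟨z, rfl⟩ := (hiq x).1 hx
      exact hfi z
    obtain ⟨h, hh⟩ := hj ((LinearMap.ker q).liftQ f.hom hker ∘ₗ
      (q.quotKerEquivOfSurjective hq).symm.toLinearMap)
    refine ⟨ModuleCat.ofHom h, ?_⟩
    ext x
    change h (j (q x)) = f.hom x
    rw [show h (j (q x)) = _ from LinearMap.congr_fun hh (q x), LinearMap.comp_apply]
    have : (q.quotKerEquivOfSurjective hq).symm (q x) = (LinearMap.ker q).mkQ x := by
      rw [LinearEquiv.symm_apply_eq]
      rfl
    rw [LinearEquiv.coe_coe, this]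
    rfl
  · rintro ⟨h, rfl⟩
    ext x
    change h.hom (j (q (i (p x)))) = 0
    rw [hiq.apply_apply_eq_zero, map_zero, map_zero]

theorem ExtOneVanishes.exists_extension {Z B C X : Type u} [AddCommGroup Z] [Module R Z]
    [AddCommGroup B] [Module R B] [AddCommGroup C] [Module R C] [AddCommGroup X] [Module R X]
    (h : ExtOneVanishes R C X) {i : Z →ₗ[R] B} {q : B →ₗ[R] C} (hi : Function.Injective i)
    (hq : Function.Surjective q) (hiq : Function.Exact i q) (f : Z →ₗ[R] X) :
    ∃ k : B →ₗ[R] X, k ∘ₗ i = f := by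
  let e : Z ≃ₗ[R] LinearMap.ker q :=
    (LinearEquiv.ofInjective i hi).trans (LinearEquiv.ofEq _ _ (LinearMap.exact_iff.1 hiq).symm)
  obtain ⟨k, hk⟩ := h B q hq (f ∘ₗ e.symm.toLinearMap)
  refine ⟨k, LinearMap.ext fun z => ?_⟩
  have := hk (e z)
  rw [LinearMap.comp_apply, LinearEquiv.coe_coe, LinearEquiv.symm_apply_apply] at this
  exact this

end Splicing

/-! ### Building complete resolutions from a closed class. -/

section Characterization

variable {R : Type u} [Ring R]

theorem exists_left_resolution {𝒮 : ObjectProperty (ModuleCat.{u} R)}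
    (hcover : ∀ G : ModuleCat.{u} R, 𝒮 G → ∃ (P : ModuleCat.{u} R) (p : P →ₗ[R] G),
      Module.Projective R P ∧ Function.Surjective p ∧ 𝒮 (ModuleCat.of R (LinearMap.ker p)))
    {G : ModuleCat.{u} R} (hG : 𝒮 G) :
    ∃ (Z T : ℕ → ModuleCat.{u} R) (_ : Z 0 ≃ₗ[R] G) (i : ∀ n, Z (n + 1) →ₗ[R] T n)
      (p : ∀ n, T n →ₗ[R] Z n), ∀ n, 𝒮 (Z n) ∧ Module.Projective R (T n) ∧
        Function.Injective (i n) ∧ Function.Surjective (p n) ∧ Function.Exact (i n) (p n) := by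
  choose P p hP hp hK using hcover
  let z : ℕ → {G : ModuleCat.{u} R // 𝒮 G} := fun n =>
    Nat.rec ⟨G, hG⟩ (fun _ Z => ⟨_, hK Z.1 Z.2⟩) n
  exact ⟨fun n => (z n).1, fun n => P (z n).1 (z n).2, LinearEquiv.refl R G,
    fun n => (LinearMap.ker (p (z n).1 (z n).2)).subtype, fun n => p (z n).1 (z n).2,
    fun n => ⟨(z n).2, hP _ _, Subtype.val_injective, hp _ _,
      LinearMap.exact_subtype_ker_map _⟩⟩

theorem exists_right_resolution {𝒮 : ObjectProperty (ModuleCat.{u} R)}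
    (hembed : ∀ G : ModuleCat.{u} R, 𝒮 G → ∃ (Q : ModuleCat.{u} R) (j : G →ₗ[R] Q),
      Module.Projective R Q ∧ Function.Injective j ∧ 𝒮 (ModuleCat.of R (Q ⧸ LinearMap.range j)))
    {G : ModuleCat.{u} R} (hG : 𝒮 G) :
    ∃ (C Q : ℕ → ModuleCat.{u} R) (_ : G ≃ₗ[R] C 0) (j : ∀ n, C n →ₗ[R] Q n)
      (q : ∀ n, Q n →ₗ[R] C (n + 1)), ∀ n, 𝒮 (C n) ∧ Module.Projective R (Q n) ∧
        Function.Injective (j n) ∧ Function.Surjective (q n) ∧ Function.Exact (j n) (q n) := by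
  choose Q j hQ hj hK using hembed
  let z : ℕ → {G : ModuleCat.{u} R // 𝒮 G} := fun n =>
    Nat.rec ⟨G, hG⟩ (fun _ Z => ⟨_, hK Z.1 Z.2⟩) n
  exact ⟨fun n => (z n).1, fun n => Q (z n).1 (z n).2, LinearEquiv.refl R G,
    fun n => j (z n).1 (z n).2, fun n => (LinearMap.range (j (z n).1 (z n).2)).mkQ,
    fun n => ⟨(z n).2, hQ _ _, hj _ _, Submodule.mkQ_surjective _,
      LinearMap.exact_map_mkQ_range _⟩⟩

/-- A class of modules with vanishing `Ext¹(-, 𝔛)` whose members have projective presentations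
and embeddings into projective modules, with kernels and cokernels in the class, consists of
`𝔛`-Gorenstein projective modules. -/
theorem IsXGorensteinProjective.of_closed {𝔛 𝒮 : ObjectProperty (ModuleCat.{u} R)}
    (hcover : ∀ G : ModuleCat.{u} R, 𝒮 G → ∃ (P : ModuleCat.{u} R) (p : P →ₗ[R] G),
      Module.Projective R P ∧ Function.Surjective p ∧ 𝒮 (ModuleCat.of R (LinearMap.ker p)))
    (hembed : ∀ G : ModuleCat.{u} R, 𝒮 G → ∃ (Q : ModuleCat.{u} R) (j : G →ₗ[R] Q),
      Module.Projective R Q ∧ Function.Injective j ∧ 𝒮 (ModuleCat.of R (Q ⧸ LinearMap.range j)))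
    (hext : ∀ G X : ModuleCat.{u} R, 𝒮 G → 𝔛 X → ExtOneVanishes R G X)
    {G : ModuleCat.{u} R} (hG : 𝒮 G) : IsXGorensteinProjective 𝔛 G := by
  obtain ⟨Z, T, eZ, i, p, hL⟩ := exists_left_resolution hcover hG
  obtain ⟨C, Q, eC, j, q, hR⟩ := exists_right_resolution hembed hG
  have hp0 : Function.Surjective ((eZ.trans eC).toLinearMap ∘ₗ p 0) :=
    (eZ.trans eC).surjective.comp (hL 0).2.2.2.1
  have hi0 : Function.Exact (i 0) ((eZ.trans eC).toLinearMap ∘ₗ p 0) := by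
    intro x
    rw [LinearMap.comp_apply, LinearEquiv.coe_coe, LinearEquiv.map_eq_zero_iff]
    exact (hL 0).2.2.2.2 x
  have hextR : ∀ X, 𝔛 X → ∀ n (f : C n →ₗ[R] X), ∃ h : Q n →ₗ[R] X, h ∘ₗ j n = f :=
    fun X hX n => (hext _ X (hR (n + 1)).1 hX).exists_extension (hR n).2.2.1 (hR n).2.2.2.1
      (hR n).2.2.2.2
  have hextL : ∀ X, 𝔛 X → ∀ n (f : Z (n + 1) →ₗ[R] X), ∃ h : T n →ₗ[R] X, h ∘ₗ i n = f :=
    fun X hX n => (hext _ X (hL n).1 hX).exists_extension (hL n).2.2.1 (hL n).2.2.2.1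
      (hL n).2.2.2.2
  -- `G` must be the kernel of the middle map, so the first projective `Q 0` containing `G` goes to
  -- the left half as `P_0`, and both halves are offset by one.
  let S : TwoSidedSequence R :=
    { left := fun
        | 0 => Q 0
        | n + 1 => T n
      right := fun n => Q (n + 1)
      dLeft := fun
        | 0 => ModuleCat.ofHom (j 0 ∘ₗ (eZ.trans eC).toLinearMap ∘ₗ p 0)
        | n + 1 => ModuleCat.ofHom (i n ∘ₗ p (n + 1))
      mid := ModuleCat.ofHom (j 1 ∘ₗ q 0)
      dRight := fun n => ModuleCat.ofHom (j (n + 2) ∘ₗ q (n + 1)) }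
  refine ⟨S, ⟨?_, fun n => (hR (n + 1)).2.1, ?_, fun X hX => ?_⟩, ⟨?_⟩⟩
  · rintro (_ | n)
    · exact (hR 0).2.1
    · exact (hL n).2.1
  · refine ⟨?_, ?_, ?_, fun n => ?_⟩
    · rintro (_ | n)
      · exact Function.Exact.comp_surjective_injective (hL 1).2.2.2.1 hi0 (hR 0).2.2.1
      · exact Function.Exact.comp_surjective_injective (hL (n + 2)).2.2.2.1 (hL (n + 1)).2.2.2.2
          (hL n).2.2.1
    · exact Function.Exact.comp_surjective_injective hp0 (hR 0).2.2.2.2 (hR 1).2.2.1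
    · exact Function.Exact.comp_surjective_injective (hR 0).2.2.2.1 (hR 1).2.2.2.2 (hR 2).2.2.1
    · exact Function.Exact.comp_surjective_injective (hR (n + 1)).2.2.2.1 (hR (n + 2)).2.2.2.2
        (hR (n + 3)).2.2.1
  · refine ⟨?_, ?_, ?_, fun n => ?_⟩
    · rintro (_ | n)
      · exact exact_precomp_of_extends (hL 1).2.2.2.1 hp0 hi0 (hextR X hX 0)
      · exact exact_precomp_of_extends (hL (n + 2)).2.2.2.1 (hL (n + 1)).2.2.2.1
          (hL (n + 1)).2.2.2.2 (hextL X hX n)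
    · exact exact_precomp_of_extends hp0 (hR 0).2.2.2.1 (hR 0).2.2.2.2 (hextR X hX 1)
    · exact exact_precomp_of_extends (hR 0).2.2.2.1 (hR 1).2.2.2.1 (hR 1).2.2.2.2 (hextR X hX 2)
    · exact exact_precomp_of_extends (hR (n + 1)).2.2.2.1 (hR (n + 2)).2.2.2.1
        (hR (n + 2)).2.2.2.2 (hextR X hX (n + 3))
  · refine eC.trans ((LinearEquiv.ofInjective (j 0) (hR 0).2.2.1).trans (LinearEquiv.ofEq _ _ ?_))
    change _ = LinearMap.ker (j 1 ∘ₗ q 0)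
    rw [LinearMap.ker_comp_of_ker_eq_bot _ (LinearMap.ker_eq_bot.2 (hR 1).2.2.1)]
    exact (LinearMap.exact_iff.1 (hR 0).2.2.2.2).symm

variable {𝔛 : ObjectProperty (ModuleCat.{u} R)}

/-- The class of projectives is closed in the required sense through identity maps, whose kernels
and cokernels are zero. -/
theorem isXGorensteinProjective_of_projective {P : ModuleCat.{u} R} (hP : Module.Projective R P) :
    IsXGorensteinProjective 𝔛 P := by
  refine IsXGorensteinProjective.of_closed
    (𝒮 := fun P : ModuleCat.{u} R => Module.Projective R P) ?_ ?_ ?_ hP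
  · intro G hG
    refine ⟨G, LinearMap.id, hG, Function.surjective_id, ?_⟩
    have : Subsingleton (LinearMap.ker (LinearMap.id : G →ₗ[R] G)) :=
      ⟨fun x y => Subtype.ext (x.2.trans y.2.symm)⟩
    exact Module.Projective.of_free (R := R) (P := LinearMap.ker (LinearMap.id : G →ₗ[R] G))
  · intro G hG
    refine ⟨G, LinearMap.id, hG, Function.injective_id, ?_⟩
    have : Subsingleton (G ⧸ LinearMap.range (LinearMap.id : G →ₗ[R] G)) := by
      rw [Submodule.Quotient.subsingleton_iff, LinearMap.range_id]
    exact Module.Projective.of_free (R := R) (P := G ⧸ LinearMap.range (LinearMap.id : G →ₗ[R] G))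
  · intro G X hG _
    refine ExtOneVanishes.of_projective LinearMap.id Function.surjective_id fun f => ⟨0, fun x => ?_⟩
    rw [show x = 0 from Subtype.ext x.2, map_zero]
    rfl

/-- `𝔛`-Gorenstein projective modules are closed under transfinite extensions. -/
theorem HasFiltration.isXGorensteinProjective
    (h𝔛 : ∀ P : ModuleCat.{u} R, Module.Projective R P → 𝔛 P) {M : ModuleCat.{u} R}
    (hM : HasFiltration (IsXGorensteinProjective 𝔛) M) : IsXGorensteinProjective 𝔛 M :=
  IsXGorensteinProjective.of_closed
    (𝒮 := fun M : ModuleCat.{u} R => HasFiltration (IsXGorensteinProjective 𝔛) M)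
    (fun _ hG => hG.exists_projective_cover fun _ hC => hC.exists_projective_cover)
    -- Here it matters that projectives belong to `𝔛`.
    (fun _ hG => hG.exists_projective_embedding (fun _ hC => hC.exists_projective_embedding)
      fun _ hC X hX => hC.extOneVanishes (h𝔛 X hX))
    (fun _ _ hG hX => hG.extOneVanishes fun _ hC => hC.extOneVanishes hX) hM

end Characterization

/-! ### Dimension bounds through syzygies. -/

section Dimension

variable {R : Type u} [Ring R]

/-- An extension of two modules in `𝒞` is filtered by `𝒞`. -/
theorem HasFiltration.of_extension {𝒞 : ObjectProperty (ModuleCat.{u} R)} {K N : ModuleCat.{u} R}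
    {M : Type u} [AddCommGroup M] [Module R M] (hK : 𝒞 K) (hN : 𝒞 N) {f : K →ₗ[R] M}
    {g : M →ₗ[R] N} (hf : Function.Injective f) (hg : Function.Surjective g)
    (hfg : Function.Exact f g) : HasFiltration 𝒞 M := by
  let F : ULift.{u} Bool → Submodule R M := fun b => bif b.down then ⊤ else LinearMap.range f
  have hF : Monotone F := by
    rintro ⟨_ | _⟩ ⟨_ | _⟩ h
    · exact le_rfl
    · exact le_top
    · exact absurd h (by decide)
    · exact le_rfl
  have hfalse : filtrationBelow F ⟨false⟩ = ⊥ :=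
    eq_bot_iff.2 (filtrationBelow_le fun b hb => absurd hb (by rcases b with ⟨_ | _⟩ <;> decide))
  have htrue : filtrationBelow F ⟨true⟩ = LinearMap.range f := by
    apply le_antisymm
    · refine filtrationBelow_le ?_
      rintro ⟨_ | _⟩ hb
      · exact le_rfl
      · exact absurd hb (by decide)
    · exact le_filtrationBelow (F := F) (j := ⟨false⟩) (by decide)
  refine ⟨ULift.{u} Bool, inferInstance, inferInstance, F, hF,
    eq_top_iff.2 (le_iSup F ⟨true⟩), ?_⟩
  rintro ⟨_ | _⟩
  · refine ⟨K, K, f, LinearMap.id, hK, ?_, Function.surjective_id, fun x => ?_⟩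
    · rw [hfalse, bot_sup_eq]
      rfl
    · rw [hfalse, Submodule.mem_bot, map_eq_zero_iff f hf]
      rfl
  · refine ⟨ModuleCat.of R M, N, LinearMap.id, g, hN, ?_, hg, fun x => ?_⟩
    · rw [LinearMap.range_id, sup_top_eq]
      rfl
    · rw [htrue]
      exact hfg x

/-- Every module is filtered by cyclic modules. -/
theorem HasFiltration.of_cyclic {𝒞 : ObjectProperty (ModuleCat.{u} R)}
    (h𝒞 : ∀ I : Ideal R, 𝒞 (ModuleCat.of R (R ⧸ I))) (M : Type u) [AddCommGroup M] [Module R M] :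
    HasFiltration 𝒞 M := by
  -- In a well-order on `M`, the quotient at `m` is generated by the class of `m`, hence is `R`
  -- modulo the ideal of all `r` with `r • m` below stage `m`.
  obtain ⟨_, _⟩ := exists_wellFoundedLT M
  let F : M → Submodule R M := fun m => Submodule.span R (Set.Iic m)
  refine ⟨M, inferInstance, inferInstance, F, fun m n h => Submodule.span_mono
    (Set.Iic_subset_Iic.2 h), eq_top_iff.2 fun m _ => Submodule.mem_iSup_of_mem m
    (Submodule.subset_span Set.self_mem_Iic), fun m => ?_⟩
  refine ⟨ModuleCat.of R R, ModuleCat.of R (R ⧸ (filtrationBelow F m).comap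
    (LinearMap.toSpanSingleton R M m)), LinearMap.toSpanSingleton R M m, Submodule.mkQ _, h𝒞 _, ?_,
    Submodule.mkQ_surjective _, fun x => ?_⟩
  · apply le_antisymm
    · refine sup_le (filtrationBelow_le fun n hn => Submodule.span_mono
        (Set.Iic_subset_Iic.2 hn.le)) ?_
      rintro _ ⟨r, rfl⟩
      exact Submodule.smul_mem _ r (Submodule.subset_span Set.self_mem_Iic)
    · refine Submodule.span_le.2 fun n hn => ?_
      rcases (Set.mem_Iic.1 hn).eq_or_lt with rfl | h
      · exact Submodule.mem_sup_right ⟨1, LinearMap.toSpanSingleton_apply_one R M n⟩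
      · exact Submodule.mem_sup_left
          (le_filtrationBelow (F := F) h (Submodule.subset_span Set.self_mem_Iic))
  · rw [Submodule.mkQ_apply, Submodule.Quotient.mk_eq_zero]
    rfl

/-- `M` has a partial projective resolution of length `n` with an `𝔛`-Gorenstein projective
`n`-th syzygy. -/
def HasXGorensteinSyzygy (𝔛 : ObjectProperty (ModuleCat.{u} R)) :
    ℕ → ObjectProperty (ModuleCat.{u} R)
  | 0 => IsXGorensteinProjective 𝔛
  | n + 1 => fun M => ∃ (P : ModuleCat.{u} R) (p : P →ₗ[R] M), Module.Projective R P ∧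
      Function.Surjective p ∧ HasXGorensteinSyzygy 𝔛 n (ModuleCat.of R (LinearMap.ker p))

variable {𝔛 : ObjectProperty (ModuleCat.{u} R)}

theorem HasXGorensteinSyzygy.succ {n : ℕ} {M : ModuleCat.{u} R}
    (h : HasXGorensteinSyzygy 𝔛 n M) : HasXGorensteinSyzygy 𝔛 (n + 1) M := by
  induction n generalizing M with
  | zero => exact IsXGorensteinProjective.exists_projective_cover h
  | succ n ih =>
    obtain ⟨P, p, hP, hp, hK⟩ := h
    exact ⟨P, p, hP, hp, ih hK⟩

theorem HasXGorensteinSyzygy.mono {m n : ℕ} (hmn : m ≤ n) {M : ModuleCat.{u} R}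
    (h : HasXGorensteinSyzygy 𝔛 m M) : HasXGorensteinSyzygy 𝔛 n M := by
  induction hmn with
  | refl => exact h
  | step _ ih => exact ih.succ

/-- Auslander's lemma for the `𝔛`-Gorenstein projective dimension. -/
theorem HasFiltration.hasXGorensteinSyzygy
    (h𝔛 : ∀ P : ModuleCat.{u} R, Module.Projective R P → 𝔛 P) {n : ℕ} {M : ModuleCat.{u} R}
    (hM : HasFiltration (HasXGorensteinSyzygy 𝔛 n) M) : HasXGorensteinSyzygy 𝔛 n M := by
  induction n generalizing M with
  | zero => exact hM.isXGorensteinProjective h𝔛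
  | succ n ih =>
    obtain ⟨P, p, hP, hp, hK⟩ := hM.exists_projective_cover
      (𝒟 := HasXGorensteinSyzygy 𝔛 n) fun _ hC => hC
    exact ⟨P, p, hP, hp, ih (M := ModuleCat.of R (LinearMap.ker p)) hK⟩

/-- A resolution of length `n + 1` of `M` gives one of length `n` of the first syzygy. -/
def XGorensteinResolution.syzygy {M : ModuleCat.{u} R} {n : ℕ}
    (r : XGorensteinResolution 𝔛 M (n + 1)) :
    XGorensteinResolution 𝔛 (ModuleCat.of R (LinearMap.ker r.augmentation.hom)) n where
  obj i := r.obj (i + 1)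
  d i := r.d (i + 1)
  augmentation := ModuleCat.ofHom ((r.d 0).hom.codRestrict _ fun x =>
    (r.exact_zero _).2 ⟨x, rfl⟩)
  augmentation_surjective := by
    rintro ⟨y, hy⟩
    obtain ⟨x, hx⟩ := (r.exact_zero y).1 hy
    exact ⟨x, Subtype.ext hx⟩
  exact_zero x := Subtype.ext_iff.trans (r.exact_succ 0 x)
  exact_succ i := r.exact_succ (i + 1)
  gorenstein i hi := r.gorenstein (i + 1) (Nat.succ_le_succ hi)
  zero_of_lt i hi := r.zero_of_lt (i + 1) (Nat.succ_lt_succ hi)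

/-- Cover `G_0` by a projective `P` with `𝔛`-Gorenstein projective kernel. The kernel of `P → M` is
then an extension of the first syzygy of `M` by that kernel, so Auslander's lemma for a two-step
filtration completes the induction. -/
theorem XGorensteinResolution.hasXGorensteinSyzygy
    (h𝔛 : ∀ P : ModuleCat.{u} R, Module.Projective R P → 𝔛 P) {n : ℕ} {M : ModuleCat.{u} R}
    (r : XGorensteinResolution 𝔛 M n) : HasXGorensteinSyzygy 𝔛 n M := by
  induction n generalizing M with
  | zero =>
    have := r.zero_of_lt 1 one_pos
    refine (r.gorenstein 0 le_rfl).of_linearEquiv (LinearEquiv.ofBijective r.augmentation.hom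
      ⟨(injective_iff_map_eq_zero _).2 fun x hx => ?_, r.augmentation_surjective⟩)
    obtain ⟨y, rfl⟩ := (r.exact_zero x).1 hx
    rw [Subsingleton.elim y 0, map_zero]
  | succ n ih =>
    have hK := ih r.syzygy
    obtain ⟨P, p, hP, hp, hG⟩ := (r.gorenstein 0 (Nat.zero_le _)).exists_projective_cover
    refine ⟨P, r.augmentation.hom ∘ₗ p, hP, r.augmentation_surjective.comp hp, ?_⟩
    have hG' : HasXGorensteinSyzygy 𝔛 n (ModuleCat.of R (LinearMap.ker p)) :=
      HasXGorensteinSyzygy.mono (Nat.zero_le n) hG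
    refine HasFiltration.hasXGorensteinSyzygy h𝔛 (M := ModuleCat.of R _)
      (HasFiltration.of_extension hG' hK
        (f := Submodule.inclusion (LinearMap.ker_le_ker_comp p r.augmentation.hom))
        (g := p.restrict fun x hx => hx) (Submodule.inclusion_injective _) ?_ ?_)
    · rintro ⟨y, hy⟩
      obtain ⟨x, rfl⟩ := hp y
      exact ⟨⟨x, hy⟩, rfl⟩
    · intro x
      refine Subtype.ext_iff.trans ⟨fun hx => ⟨⟨x.1, hx⟩, rfl⟩, ?_⟩
      rintro ⟨y, rfl⟩
      exact y.2

/-- Projectives are `𝔛`-Gorenstein projective, so the partial projective resolution completed by its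
last syzygy is a resolution of the required kind. -/
theorem HasXGorensteinSyzygy.nonempty_resolution {n : ℕ} {M : ModuleCat.{u} R}
    (h : HasXGorensteinSyzygy 𝔛 n M) : Nonempty (XGorensteinResolution 𝔛 M n) := by
  induction n generalizing M with
  | zero =>
    refine ⟨{ obj := fun | 0 => M | _ + 1 => ModuleCat.of R PUnit
              d := fun _ => 0
              augmentation := 𝟙 M
              augmentation_surjective := Function.surjective_id
              exact_zero := ?_
              exact_succ := ?_
              gorenstein := ?_
              zero_of_lt := ?_ }⟩
    · intro x
      refine ⟨fun hx => ⟨0, hx.symm⟩, ?_⟩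
      rintro ⟨y, rfl⟩
      rfl
    · intro i x
      exact ⟨fun _ => ⟨0, Subsingleton.elim (α := PUnit) _ _⟩, fun _ => rfl⟩
    · intro i hi
      obtain rfl := Nat.le_zero.1 hi
      exact h
    · rintro (_ | i) hi
      · exact absurd hi (lt_irrefl 0)
      · exact inferInstanceAs (Subsingleton PUnit)
  | succ n ih =>
    obtain ⟨P, p, hP, hp, hK⟩ := h
    obtain ⟨r⟩ := ih hK
    refine ⟨{ obj := fun | 0 => P | i + 1 => r.obj i
              d := fun
                | 0 => ModuleCat.ofHom ((LinearMap.ker p).subtype ∘ₗ r.augmentation.hom)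
                | i + 1 => r.d i
              augmentation := ModuleCat.ofHom p
              augmentation_surjective := hp
              exact_zero := ?_
              exact_succ := ?_
              gorenstein := ?_
              zero_of_lt := ?_ }⟩
    · intro x
      constructor
      · intro hx
        obtain ⟨y, hy⟩ := r.augmentation_surjective ⟨x, hx⟩
        exact ⟨y, congrArg Subtype.val hy⟩
      · rintro ⟨y, rfl⟩
        exact (r.augmentation.hom y).2
    · rintro (_ | i)
      · intro x
        exact Subtype.ext_iff.symm.trans (r.exact_zero x)
      · exact r.exact_succ i
    · rintro (_ | i) hi
      · exact isXGorensteinProjective_of_projective hP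
      · exact r.gorenstein i (Nat.le_of_succ_le_succ hi)
    · rintro (_ | i) hi
      · exact absurd hi (Nat.not_lt_zero _)
      · exact r.zero_of_lt i (Nat.lt_of_succ_lt_succ hi)

theorem xGpd_le_iff (h𝔛 : ∀ P : ModuleCat.{u} R, Module.Projective R P → 𝔛 P)
    {M : ModuleCat.{u} R} {n : ℕ} : xGpd 𝔛 M ≤ n ↔ HasXGorensteinSyzygy 𝔛 n M := by
  constructor
  · intro h
    have hne : {k : ℕ∞ | ∃ n : ℕ, k = n ∧ Nonempty (XGorensteinResolution 𝔛 M n)}.Nonempty := by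
      by_contra hempty
      rw [xGpd, Set.not_nonempty_iff_eq_empty.1 hempty, sInf_empty, top_le_iff] at h
      exact ENat.natCast_ne_top n h
    -- A nonempty infimum in `ℕ∞` is attained, giving an actual resolution of length `m ≤ n`.
    obtain ⟨m, hm, ⟨r⟩⟩ := csInf_mem hne
    have hmn : m ≤ n := by
      have h' : ((m : ℕ∞)) ≤ n := hm ▸ h
      exact_mod_cast h'
    exact (r.hasXGorensteinSyzygy h𝔛).mono hmn
  · intro h
    exact sInf_le ⟨n, rfl, h.nonempty_resolution⟩

theorem leftXGgldim_le_of_quotient (h𝔛 : ∀ P : ModuleCat.{u} R, Module.Projective R P → 𝔛 P)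
    {n : ℕ} (h : ∀ I : Ideal R, xGpd 𝔛 (ModuleCat.of R (R ⧸ I)) ≤ n) : leftXGgldim 𝔛 ≤ n :=
  iSup_le fun M => (xGpd_le_iff h𝔛).2 <| HasFiltration.hasXGorensteinSyzygy h𝔛 <|
    HasFiltration.of_cyclic (fun I => (xGpd_le_iff h𝔛).1 (h I)) M

end Dimension

theorem mainTheorem1 {R : Type u} [Ring R] (𝔛 : ObjectProperty (ModuleCat.{u} R))
    (h𝔛 : ∀ P : ModuleCat.{u} R, Module.Projective R P → 𝔛 P) :
    (∀ n : ℕ, List.TFAE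
      [leftXGgldim 𝔛 ≤ n,
       ∀ M : ModuleCat.{u} R, Module.Finite R M → xGpd 𝔛 M ≤ n,
       ∀ I : Ideal R, xGpd 𝔛 (ModuleCat.of R (R ⧸ I)) ≤ n]) ∧
    leftXGgldim 𝔛 = (⨆ (M : ModuleCat.{u} R) (_ : Module.Finite R M), xGpd 𝔛 M) ∧
    leftXGgldim 𝔛 = (⨆ I : Ideal R, xGpd 𝔛 (ModuleCat.of R (R ⧸ I))) := by
  have hquot : leftXGgldim 𝔛 ≤ ⨆ I : Ideal R, xGpd 𝔛 (ModuleCat.of R (R ⧸ I)) := by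
    -- If the supremum is finite it is itself a natural-number bound for all `R ⧸ I`; otherwise
    -- there is nothing to prove.
    induction hs : ⨆ I : Ideal R, xGpd 𝔛 (ModuleCat.of R (R ⧸ I)) using ENat.recTopCoe with
    | top => exact le_top
    | coe n =>
      exact leftXGgldim_le_of_quotient h𝔛 fun I =>
        (le_iSup (fun I : Ideal R => xGpd 𝔛 (ModuleCat.of R (R ⧸ I))) I).trans hs.le
  have hfin : (⨆ I : Ideal R, xGpd 𝔛 (ModuleCat.of R (R ⧸ I))) ≤
      ⨆ (M : ModuleCat.{u} R) (_ : Module.Finite R M), xGpd 𝔛 M :=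
    iSup_le fun I => le_iSup₂_of_le (ModuleCat.of R (R ⧸ I))
      (inferInstanceAs (Module.Finite R (R ⧸ I))) le_rfl
  have hall : (⨆ (M : ModuleCat.{u} R) (_ : Module.Finite R M), xGpd 𝔛 M) ≤ leftXGgldim 𝔛 :=
    iSup₂_le fun M _ => le_iSup (fun M : ModuleCat.{u} R => xGpd 𝔛 M) M
  refine ⟨fun n => ?_, le_antisymm (hquot.trans hfin) hall,
    le_antisymm hquot (hfin.trans hall)⟩
  tfae_have 1 → 2 := fun h M _ => (le_iSup (fun M : ModuleCat.{u} R => xGpd 𝔛 M) M).trans h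
  tfae_have 2 → 3 := fun h I =>
    h (ModuleCat.of R (R ⧸ I)) (inferInstanceAs (Module.Finite R (R ⧸ I)))
  tfae_have 3 → 1 := leftXGgldim_le_of_quotient h𝔛
  tfae_finish
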